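/- Let $f>0$ and $c_f=\frac{f}{1+f}\in(0,1)$. Then there is a function $y_f:[c_f,1]\to[0,1]$ with $y_f(c_f)=0$ that solves the functional differential equation $$ y'(y(t))=\frac{y(t)-c_f}{t-c_f}\left(2-\frac{y(t)}{y'(t)\,(t-c_f)}\right)\qquad\text{for all } t\in[c_f,1]\text{ with } y(t)\ge c_f , $$ $$ y(t)=\frac{(t-c_f)^2}{1-c_f}-1+c_f+y(1)\qquad\text{for all } t\in[c_f,1]\text{ with } t\ge y(1). $$ Here the first equation includes the existence of the derivatives involved and $y'(t)\neq 0$. It holds with ordinary derivatives (relative to the domain $[c_f,1]$) at every $t$ that is not one of the breakpoints $r_0=1$, $r_{i+1}=y(r_i)$ (continued while $r_i\ge c_f$). At all $t$, breakpoints included, it holds separately with left derivatives at $t$ and at $y(t)$ (when $y(t)>c_f$) and with right derivatives at $t$ and at $y(t)$ (when $t<1$). Moreover: (i) $y_f$ is continuous and strictly increasing on $[c_f,1]$, and $y_f(t)<t$ for all $t\in[c_f,1]$. (ii) $\frac{y_f(t)}{t-c_f}$ is strictly increasing on $(c_f,1]$; equivalently, $\frac{t}{y_f^{-1}(t)-c_f}$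 is strictly increasing on $(0,y_f(1)]$. (iii) There is an integer $n\ge 0$ with $n\le 1+\frac1f$ such that the iterates $y_f^{(i)}(1)$, $0\le i<n$, lie in $[c_f,1]$ (so that the $n$-fold composition $y_f^{(n)}(1)$ is defined) and $y_f^{(n)}(1)\le c_f$. -/

import Mathlib

open Set

namespace Buyback

/-- The constant `c_f = f / (1 + f)`. -/
noncomputable def c (f : ℝ) : ℝ := f / (1 + f)

/-- The breakpoints `r_0 = 1`, `r_{i+1} = y (r_i)`, continued as long as `r_i` lies in the domain
`[k₁, 1]` of `y`. -/
def breakpoints (k₁ : ℝ) (y : ℝ → ℝ) : Set ℝ :=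
  {r | ∃ n : ℕ, (∀ i < n, y^[i] 1 ∈ Icc k₁ 1) ∧ y^[n] 1 = r}

/-- The equation
`y'(y(t)) = (y(t) - c_f) / (t - c_f) * (2 - y(t) / (y'(t) (t - c_f)))` at the point `t`, where
`y'(t)` is the derivative of `y` at `t` relative to the set `S` and `y'(y(t))` is the derivative
of `y` at `y(t)` relative to the set `T`. Both derivatives exist, and `y'(t) ≠ 0`. -/
def EqAt (f : ℝ) (y : ℝ → ℝ) (S T : Set ℝ) (t : ℝ) : Prop :=
  ∃ d e : ℝ, HasDerivWithinAt y d S t ∧ HasDerivWithinAt y e T (y t) ∧ d ≠ 0 ∧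
    e = (y t - c f) / (t - c f) * (2 - y t / (d * (t - c f)))

/-- `y : [k₁, 1] → [0, 1]` solves the functional differential equation with parameters `f` and
`k₁`. Only the values of `y` on `[k₁, 1]` matter. Away from the breakpoints the equation holds
with the ordinary derivative (of a function on `[k₁, 1]`, so one-sided at `k₁`); at every point,
breakpoints included, it holds for the left and for the right derivatives separately. -/
structure IsSolution (f k₁ : ℝ) (y : ℝ → ℝ) : Prop where
  mapsTo : MapsTo y (Icc k₁ 1) (Icc 0 1)
  map_left : y k₁ = 0
  eq_ordinary : ∀ t ∈ Icc k₁ 1, k₁ ≤ y t → t ∉ breakpoints k₁ y →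
    EqAt f y (Icc k₁ 1) (Icc k₁ 1) t
  eq_left : ∀ t ∈ Icc k₁ 1, k₁ < y t → EqAt f y (Icc k₁ t) (Icc k₁ (y t)) t
  eq_right : ∀ t ∈ Ico k₁ 1, k₁ ≤ y t → EqAt f y (Icc t 1) (Icc (y t) 1) t
  initial : ∀ t ∈ Icc k₁ 1, y 1 ≤ t → y t = (t - c f) ^ 2 / (1 - c f) - 1 + c f + y 1

end Buyback

/-! The affine map of `[c f, 1]` onto `[0, 1]` turns the equation into `Z'(Z(s)) = Z(s)/s * (2 -
(Z(s) + f)/(s Z'(s)))` with `Z(0) = -f`. Multiplied by `Z'(s)`, it says that `Z(s)²/s - Z(Z(s)) - f`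
has derivative `f Z(s)/s²`. The prescribed quadratic fixes the value of this expression at `s = 1`
as `1 - u - f`, where `u = Z(1)`; the expression is therefore `deficit`. With `w = Z⁻¹(z)` this
becomes the fixed point equation `Z(z) = z²/w - f - deficit(w)` on `[0, u]`.

`step` is this operator with the deficit cut off below at `0`; the cutoff makes it preserve
`Admissible` (`admissible_step`). Monotonicity of `(Z(s) + f)/s` and `u ≤ 1 - f` force `Z(s) ≤ s -
f`, so `step` at `z` only uses `Z` on `[z + f, 1]`. Hence the iterates become stationary on `[0, 1]`
after finitely many steps (`approx_stable`), which gives a fixed point for each `u`, continuous in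
`u`, without any contraction estimate.

It remains to choose `u`. By the intermediate value theorem some `u` makes the deficit vanish at the
zero of `Z` (`exists_integralSolution`); then the cutoff is inactive and `Z(0) = -f`.
Differentiability spreads from the quadratic on `[u, 1]` downwards in steps of `f`
(`exists_deriv_of_le`). For `f ≥ 1` the quadratic itself is a solution. -/

namespace Buyback

/-! ### The truncated integral operator and its invariant class. -/

/-- The functions on which the truncated integral operator acts: continuous, strictly increasing on
`[0, 1]`, with `(Z s + f) / s` strictly increasing, and with the prescribed value `u` at `1`. -/
structure Admissible (f u : ℝ) (Z : ℝ → ℝ) : Prop where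
  cont : Continuous Z
  mono : StrictMonoOn Z (Icc 0 1)
  ratio : StrictMonoOn (fun s => (Z s + f) / s) (Ioc 0 1)
  map_zero : Z 0 < 0
  map_one : Z 1 = u

/-- The inverse of `Z` on `[0, 1]`. -/
noncomputable def inv (Z : ℝ → ℝ) (z : ℝ) : ℝ := Function.invFunOn Z (Icc 0 1) z

/-- The value at `s` of the function `Z(s)² / s - Z(Z(s)) - f` for a solution `Z`, expressed by its
value at `1` and its derivative. -/
noncomputable def deficit (f u : ℝ) (Z : ℝ → ℝ) (s : ℝ) : ℝ :=
  1 - u - f - ∫ σ in s..1, f * Z σ / (max σ f) ^ 2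

/-- The truncated integral operator. -/
noncomputable def step (f u : ℝ) (Z : ℝ → ℝ) (z : ℝ) : ℝ :=
  (max 0 (min z u)) ^ 2 / inv Z (max 0 (min z u)) - f
    - max 0 (deficit f u Z (inv Z (max 0 (min z u)))) + ((max z u) ^ 2 - u ^ 2)

section
variable {f u : ℝ} {Z : ℝ → ℝ}

theorem Admissible.inv_spec (h : Admissible f u Z) {z : ℝ} (hz : z ∈ Icc 0 u) :
    inv Z z ∈ Icc (0 : ℝ) 1 ∧ Z (inv Z z) = z := by
  have : ∃ a ∈ Icc (0 : ℝ) 1, Z a = z := by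
    have := intermediate_value_Icc (zero_le_one' ℝ) h.cont.continuousOn
    refine this ⟨h.map_zero.le.trans hz.1, ?_⟩
    rw [h.map_one]; exact hz.2
  exact ⟨Function.invFunOn_mem this, Function.invFunOn_eq this⟩

theorem Admissible.inv_pos (h : Admissible f u Z) {z : ℝ} (hz : z ∈ Icc 0 u) : 0 < inv Z z := by
  obtain ⟨h1, h2⟩ := h.inv_spec hz
  rcases h1.1.eq_or_lt with h3 | h3
  · rw [← h3] at h2
    linarith [h.map_zero, hz.1]
  · exact h3

theorem Admissible.inv_eq (h : Admissible f u Z) {s : ℝ} (hs : s ∈ Icc (0 : ℝ) 1)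
    (hz : 0 ≤ Z s) : inv Z (Z s) = s := by
  have hz' : Z s ∈ Icc 0 u :=
    ⟨hz, h.map_one ▸ h.mono.monotoneOn hs (right_mem_Icc.2 zero_le_one) hs.2⟩
  exact h.mono.injOn (h.inv_spec hz').1 hs (h.inv_spec hz').2

theorem Admissible.inv_u (h : Admissible f u Z) (hu : 0 ≤ u) : inv Z u = 1 := by
  have := h.inv_eq (s := 1) (by simp) (by rw [h.map_one]; exact hu)
  rwa [h.map_one] at this

/-- The increasing ratio `(Z s + f) / s` is at most its value `u + f ≤ 1` at `1`. This gap of `f`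
drives every induction below. -/
theorem Admissible.le_sub (h : Admissible f u Z) (hu : u ≤ 1 - f) {s : ℝ} (hs : s ∈ Ioc (0 : ℝ) 1) :
    Z s ≤ s - f := by
  have := h.ratio.monotoneOn hs (by simp : (1 : ℝ) ∈ Ioc (0 : ℝ) 1) hs.2
  simp only [h.map_one, div_one] at this
  rw [div_le_iff₀ hs.1] at this
  nlinarith [hs.1]

theorem Admissible.add_le_inv (h : Admissible f u Z) (hu : u ≤ 1 - f) {z : ℝ} (hz : z ∈ Icc 0 u) :
    z + f ≤ inv Z z := by
  have := h.le_sub hu ⟨h.inv_pos hz, (h.inv_spec hz).1.2⟩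
  rw [(h.inv_spec hz).2] at this
  linarith

theorem Admissible.inv_strictMono (h : Admissible f u Z) : StrictMonoOn (inv Z) (Icc 0 u) := by
  intro a ha b hb hab
  by_contra! hc
  have := h.mono.monotoneOn (h.inv_spec hb).1 (h.inv_spec ha).1 hc
  rw [(h.inv_spec hb).2, (h.inv_spec ha).2] at this
  linarith

/-- By monotonicity, `a < inv (G p) (m p)` amounts to `G p a < m p` for `a` in `[0, 1]`, an open
condition in `p`; likewise from above. The parameter serves the later variation of `u`. -/
theorem continuous_inv {P : Type*} [TopologicalSpace P] {u m : P → ℝ} {G : P → ℝ → ℝ}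
    (hG : Continuous (Function.uncurry G)) (hA : ∀ p, Admissible f (u p) (G p))
    (hm : Continuous m) (hm' : ∀ p, m p ∈ Icc 0 (u p)) :
    Continuous fun p => inv (G p) (m p) := by
  have hs (s : ℝ) : Continuous fun p => G p s := hG.comp (by fun_prop : Continuous fun p => (p, s))
  refine continuous_iff_continuousAt.2 fun p => tendsto_order.2 ⟨fun a ha => ?_, fun a ha => ?_⟩
  · rcases lt_or_ge a 0 with h0 | h0
    · exact Filter.Eventually.of_forall fun q => h0.trans_le ((hA q).inv_spec (hm' q)).1.1
    · have ha1 : a ∈ Icc (0 : ℝ) 1 := ⟨h0, ha.le.trans ((hA p).inv_spec (hm' p)).1.2⟩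
      have h1 : G p a < m p := by
        have := (hA p).mono ha1 ((hA p).inv_spec (hm' p)).1 ha
        rwa [((hA p).inv_spec (hm' p)).2] at this
      filter_upwards [(hs a).continuousAt.eventually_lt hm.continuousAt h1] with q hq
      by_contra! hc
      have := (hA q).mono.monotoneOn ((hA q).inv_spec (hm' q)).1 ha1 hc
      rw [((hA q).inv_spec (hm' q)).2] at this
      linarith
  · rcases lt_or_ge 1 a with h0 | h0
    · exact Filter.Eventually.of_forall fun q => ((hA q).inv_spec (hm' q)).1.2.trans_lt h0
    · have ha1 : a ∈ Icc (0 : ℝ) 1 := ⟨((hA p).inv_spec (hm' p)).1.1.trans ha.le, h0⟩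
      have h1 : m p < G p a := by
        have := (hA p).mono ((hA p).inv_spec (hm' p)).1 ha1 ha
        rwa [((hA p).inv_spec (hm' p)).2] at this
      filter_upwards [hm.continuousAt.eventually_lt (hs a).continuousAt h1] with q hq
      by_contra! hc
      have := (hA q).mono.monotoneOn ha1 ((hA q).inv_spec (hm' q)).1 hc
      rw [((hA q).inv_spec (hm' q)).2] at this
      linarith

theorem continuous_integrand {P : Type*} [TopologicalSpace P] (hf : 0 < f) {G : P → ℝ → ℝ}
    (hG : Continuous (Function.uncurry G)) :
    Continuous (Function.uncurry fun p σ => f * G p σ / (max σ f) ^ 2) := by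
  have : Continuous fun x : P × ℝ => f * Function.uncurry G x / (max x.2 f) ^ 2 := by
    refine Continuous.div (by fun_prop) (by fun_prop) fun x => ?_
    have : 0 < max x.2 f := lt_max_of_lt_right hf
    positivity
  exact this

theorem continuous_integrand' (hf : 0 < f) (hZ : Continuous Z) :
    Continuous fun σ => f * Z σ / (max σ f) ^ 2 := by
  refine Continuous.div (by fun_prop) (by fun_prop) fun x => ?_
  have : 0 < max x f := lt_max_of_lt_right hf
  positivity

theorem continuous_deficit {P : Type*} [TopologicalSpace P] (hf : 0 < f) {u w : P → ℝ}
    {G : P → ℝ → ℝ} (hG : Continuous (Function.uncurry G)) (hu : Continuous u)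
    (hw : Continuous w) : Continuous fun p => deficit f (u p) (G p) (w p) := by
  have := intervalIntegral.continuous_parametric_intervalIntegral_of_continuous
    (μ := MeasureTheory.volume) (a₀ := 1) (continuous_integrand hf hG) hw
  simp only [deficit]
  simp_rw [intervalIntegral.integral_symm 1 (w _)]
  fun_prop

theorem continuous_step {X : Type*} [TopologicalSpace X] (hf : 0 < f) {u : X → ℝ} {G : X → ℝ → ℝ}
    (hG : Continuous (Function.uncurry G)) (hu : Continuous u)
    (hA : ∀ x, Admissible f (u x) (G x)) (h0 : ∀ x, 0 ≤ u x) :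
    Continuous (Function.uncurry fun x => step f (u x) (G x)) := by
  have hG' : Continuous (Function.uncurry fun p : X × ℝ => G p.1) :=
    hG.comp (by fun_prop : Continuous fun q : (X × ℝ) × ℝ => (q.1.1, q.2))
  have hm : Continuous fun p : X × ℝ => max 0 (min p.2 (u p.1)) := by fun_prop
  have hm' (p : X × ℝ) : max 0 (min p.2 (u p.1)) ∈ Icc 0 (u p.1) := by
    simp [h0]
  have hw := continuous_inv (u := fun p : X × ℝ => u p.1) (G := fun p : X × ℝ => G p.1) hG'
    (fun p => hA p.1) hm hm'
  have hd := continuous_deficit hf hG' (by fun_prop : Continuous fun p : X × ℝ => u p.1) hw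
  have hq := (hm.pow 2).div hw fun p => ((hA p.1).inv_pos (hm' p)).ne'
  have : Continuous fun p : X × ℝ => (max 0 (min p.2 (u p.1))) ^ 2 /
      inv (G p.1) (max 0 (min p.2 (u p.1))) - f
      - max 0 (deficit f (u p.1) (G p.1) (inv (G p.1) (max 0 (min p.2 (u p.1)))))
      + ((max p.2 (u p.1)) ^ 2 - (u p.1) ^ 2) :=
    ((hq.sub continuous_const).sub (continuous_const.max hd)).add (by fun_prop)
  exact this

theorem step_of_ge (h : Admissible f u Z) (hu : 0 ≤ u) (hu' : u ≤ 1 - f) {z : ℝ} (hz : u ≤ z) :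
    step f u Z z = z ^ 2 - 1 + u := by
  have : deficit f u Z 1 = 1 - u - f := by simp [deficit]
  simp only [step, min_eq_right hz, max_eq_right hu, h.inv_u hu, max_eq_left hz, this]
  -- The deficit at `1` is `1 - u - f ≥ 0`, so the cutoff does nothing here.
  rw [max_eq_right (by linarith)]
  ring

theorem step_of_mem {z : ℝ} (hz : z ∈ Icc 0 u) :
    step f u Z z = z ^ 2 / inv Z z - f - max 0 (deficit f u Z (inv Z z)) := by
  simp [step, min_eq_left hz.2, max_eq_right hz.1, max_eq_right hz.2]

theorem deficit_sub (hf : 0 < f) (hZ : Continuous Z) (a b : ℝ) :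
    deficit f u Z b - deficit f u Z a = ∫ σ in a..b, f * Z σ / (max σ f) ^ 2 := by
  have hi := fun a b => (continuous_integrand' hf hZ).intervalIntegrable
    (μ := MeasureTheory.volume) a b
  have := intervalIntegral.integral_add_adjacent_intervals (hi a b) (hi b 1)
  simp only [deficit]
  linarith

theorem integral_inv_sq {a b : ℝ} (ha : 0 < a) (hab : a ≤ b) (k : ℝ) :
    ∫ σ in a..b, k / σ ^ 2 = k * (1 / a - 1 / b) := by
  have h0 : ∀ x ∈ uIcc a b, x ≠ 0 := fun x hx => by
    rw [uIcc_of_le hab] at hx; linarith [hx.1]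
  rw [intervalIntegral.integral_eq_sub_of_hasDerivAt (f := fun x => -(k / x))]
  · ring
  · intro x hx
    have := ((hasDerivAt_const x k).div (hasDerivAt_id x) (h0 x hx)).neg
    convert! this using 1
    simp
    field_simp [h0 x hx]
  · refine ContinuousOn.intervalIntegrable (ContinuousOn.div (by fun_prop) (by fun_prop) ?_)
    intro x hx
    exact pow_ne_zero _ (h0 x hx)

/-- Between the two inverse points `Z` is at most `z₂`, and `f / σ²` integrates to the difference of
`f / σ`. Cutting off at `0` cannot enlarge a nonnegative increment. -/
theorem Admissible.truncated_deficit_sub_le (h : Admissible f u Z) (hf : 0 < f) (hu : u ≤ 1 - f)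
    {z₁ z₂ : ℝ} (h1 : z₁ ∈ Icc 0 u) (h2 : z₂ ∈ Icc 0 u) (h12 : z₁ ≤ z₂) :
    max 0 (deficit f u Z (inv Z z₂)) - max 0 (deficit f u Z (inv Z z₁)) ≤
      z₂ * (f / inv Z z₁ - f / inv Z z₂) := by
  have hw : inv Z z₁ ≤ inv Z z₂ := h.inv_strictMono.monotoneOn h1 h2 h12
  have hw1 : f ≤ inv Z z₁ := by linarith [h.add_le_inv hu h1, h1.1]
  have hd := deficit_sub (u := u) hf h.cont (inv Z z₁) (inv Z z₂)
  have hmem : ∀ σ ∈ Icc (inv Z z₁) (inv Z z₂), z₁ ≤ Z σ ∧ Z σ ≤ z₂ := by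
    intro σ hσ
    have hσ' : σ ∈ Icc (0 : ℝ) 1 :=
      ⟨(h.inv_spec h1).1.1.trans hσ.1, hσ.2.trans (h.inv_spec h2).1.2⟩
    have e1 := h.mono.monotoneOn (h.inv_spec h1).1 hσ' hσ.1
    have e2 := h.mono.monotoneOn hσ' (h.inv_spec h2).1 hσ.2
    rw [(h.inv_spec h1).2] at e1
    rw [(h.inv_spec h2).2] at e2
    exact ⟨e1, e2⟩
  have hnn : 0 ≤ ∫ σ in (inv Z z₁)..(inv Z z₂), f * Z σ / (max σ f) ^ 2 := by
    refine intervalIntegral.integral_nonneg hw fun σ hσ => ?_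
    have := h1.1.trans (hmem σ hσ).1
    positivity
  have hle : ∫ σ in (inv Z z₁)..(inv Z z₂), f * Z σ / (max σ f) ^ 2 ≤
      ∫ σ in (inv Z z₁)..(inv Z z₂), (f * z₂) / σ ^ 2 := by
    refine intervalIntegral.integral_mono_on hw
      ((continuous_integrand' hf h.cont).intervalIntegrable _ _) ?_ fun σ hσ => ?_
    · refine ContinuousOn.intervalIntegrable (ContinuousOn.div (by fun_prop) (by fun_prop) ?_)
      intro x hx
      rw [uIcc_of_le hw] at hx
      have : 0 < x := by linarith [hx.1]
      positivity
    · rw [max_eq_left (hw1.trans hσ.1)]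
      have := (hmem σ hσ).2
      gcongr
  rw [integral_inv_sq (by linarith) hw] at hle
  have key : max 0 (deficit f u Z (inv Z z₂)) - max 0 (deficit f u Z (inv Z z₁)) ≤
      deficit f u Z (inv Z z₂) - deficit f u Z (inv Z z₁) := by
    rcases max_cases 0 (deficit f u Z (inv Z z₂)) with ⟨h3, _⟩ | ⟨h3, _⟩ <;>
    rcases max_cases 0 (deficit f u Z (inv Z z₁)) with ⟨h4, _⟩ | ⟨h4, _⟩ <;>
    rw [h3, h4] <;> linarith
  calc _ ≤ _ := key
    _ ≤ _ := hd.trans_le hle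
    _ = _ := by ring

theorem Admissible.ratio_inv (h : Admissible f u Z) {z₁ z₂ : ℝ} (h1 : z₁ ∈ Icc 0 u)
    (h2 : z₂ ∈ Icc 0 u) (h12 : z₁ < z₂) :
    (z₁ + f) / inv Z z₁ < (z₂ + f) / inv Z z₂ := by
  have := h.ratio ⟨h.inv_pos h1, (h.inv_spec h1).1.2⟩ ⟨h.inv_pos h2, (h.inv_spec h2).1.2⟩
    (h.inv_strictMono h1 h2 h12)
  simpa only [(h.inv_spec h1).2, (h.inv_spec h2).2] using this

/-- With `p, q` the values of `z / inv Z z` and `r, t` those of `f / inv Z z`, the increment is at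
least `z₂ ((q + t) - (p + r)) + (z₂ - z₁) p`, whose first term is positive by monotonicity of the
ratio. -/
theorem Admissible.step_lt (h : Admissible f u Z) (hf : 0 < f) (hu : u ≤ 1 - f)
    {z₁ z₂ : ℝ} (h1 : z₁ ∈ Icc 0 u) (h2 : z₂ ∈ Icc 0 u) (h12 : z₁ < z₂) :
    step f u Z z₁ < step f u Z z₂ := by
  have hD := h.truncated_deficit_sub_le hf hu h1 h2 h12.le
  have hr := h.ratio_inv h1 h2 h12
  rw [step_of_mem h1, step_of_mem h2]
  have e1 : 0 ≤ z₁ / inv Z z₁ := div_nonneg h1.1 (h.inv_pos h1).le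
  rw [add_div, add_div] at hr
  have e2 : z₁ ^ 2 / inv Z z₁ = z₁ * (z₁ / inv Z z₁) := by ring
  have e3 : z₂ ^ 2 / inv Z z₂ = z₂ * (z₂ / inv Z z₂) := by ring
  rw [e2, e3]
  generalize z₁ / inv Z z₁ = p at *
  generalize z₂ / inv Z z₂ = q at *
  generalize f / inv Z z₁ = r at *
  generalize f / inv Z z₂ = t at *
  nlinarith [mul_pos (sub_pos.2 h12) (sub_pos.2 hr), mul_nonneg (sub_pos.2 h12).le e1,
    mul_nonneg h1.1 (sub_pos.2 hr).le]

/-- The ratio equals `z / w - D / z`, where `w` is the inverse and `D` the truncated deficit. The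
sign `D ≥ 0` allows replacing `D₁ / z₁` by `D₁ / z₂`, which is the purpose of the cutoff. -/
theorem Admissible.step_ratio_lt (h : Admissible f u Z) (hf : 0 < f) (hu : u ≤ 1 - f)
    {z₁ z₂ : ℝ} (h0 : 0 < z₁) (h2 : z₂ ≤ u) (h12 : z₁ < z₂) :
    (step f u Z z₁ + f) / z₁ < (step f u Z z₂ + f) / z₂ := by
  have h1' : z₁ ∈ Icc 0 u := ⟨h0.le, h12.le.trans h2⟩
  have h2' : z₂ ∈ Icc 0 u := ⟨(h0.trans h12).le, h2⟩
  have hD := h.truncated_deficit_sub_le hf hu h1' h2' h12.le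
  have hr := h.ratio_inv h1' h2' h12
  rw [step_of_mem h1', step_of_mem h2']
  rw [add_div, add_div] at hr
  have hz2 : 0 < z₂ := h0.trans h12
  have e (z D w : ℝ) (hz : 0 < z) : (z ^ 2 / w - f - D + f) / z = z / w - D / z := by
    field_simp
    ring
  rw [e _ _ _ h0, e _ _ _ hz2]
  have hm : 0 ≤ max 0 (deficit f u Z (inv Z z₁)) := le_max_left _ _
  generalize max 0 (deficit f u Z (inv Z z₁)) = D₁ at *
  generalize max 0 (deficit f u Z (inv Z z₂)) = D₂ at *
  have e1 : D₁ / z₂ ≤ D₁ / z₁ := by gcongr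
  have e2 : (D₂ - D₁) / z₂ ≤ f / inv Z z₁ - f / inv Z z₂ := by
    rw [div_le_iff₀ hz2]; linarith
  rw [sub_div] at e2
  linarith

theorem admissible_step (h : Admissible f u Z) (hf : 0 < f) (hu : 0 ≤ u) (hu' : u ≤ 1 - f) :
    Admissible f u (step f u Z) where
  cont := by
    have := continuous_step (X := Unit) (u := fun _ => u) (G := fun _ => Z) hf
      (h.cont.comp continuous_snd) (by fun_prop) (fun _ => h) (fun _ => hu)
    exact this.comp (by fun_prop : Continuous fun z : ℝ => ((), z))
  mono := by
    intro a ha b hb hab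
    have hi : ∀ {a b}, u ≤ a → a < b → step f u Z a < step f u Z b := by
      intro a b ha hab
      rw [step_of_ge h hu hu' ha, step_of_ge h hu hu' (ha.trans hab.le)]
      nlinarith
    rcases le_or_gt b u with hbu | hbu
    · exact h.step_lt hf hu' ⟨ha.1, hab.le.trans hbu⟩ ⟨hb.1, hbu⟩ hab
    · rcases le_or_gt u a with hau | hau
      · exact hi hau hab
      · exact (h.step_lt hf hu' ⟨ha.1, hau.le⟩ ⟨hu, le_rfl⟩ hau).trans (hi le_rfl hbu)
  ratio := by
    intro a ha b hb hab
    have hi : ∀ {a b}, 0 < a → u ≤ a → a < b →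
        (step f u Z a + f) / a < (step f u Z b + f) / b := by
      intro a b h0 ha hab
      rw [step_of_ge h hu hu' ha, step_of_ge h hu hu' (ha.trans hab.le),
        div_lt_div_iff₀ h0 (h0.trans hab)]
      nlinarith [mul_pos (mul_pos h0 (h0.trans hab)) (sub_pos.2 hab)]
    show (step f u Z a + f) / a < (step f u Z b + f) / b
    rcases le_or_gt b u with hbu | hbu
    · exact h.step_ratio_lt hf hu' ha.1 hbu hab
    · rcases le_or_gt u a with hau | hau
      · exact hi ha.1 hau hab
      · exact (h.step_ratio_lt hf hu' ha.1 le_rfl hau).trans (hi (ha.1.trans hau) le_rfl hbu)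
  map_zero := by
    rw [step_of_mem ⟨le_rfl, hu⟩]
    have : 0 ≤ max 0 (deficit f u Z (inv Z 0)) := le_max_left _ _
    simp only [ne_eq, OfNat.ofNat_ne_zero, not_false_eq_true, zero_pow, zero_div]
    linarith
  map_one := by
    rw [step_of_ge h hu hu' (by linarith)]
    ring

/-- Both the inverse at `z` and the integral from it to `1` see only arguments at least `z + f` (or
just `1`, if `z ≥ u`). -/
theorem step_congr {A B : ℝ → ℝ} (hA : Admissible f u A) (hB : Admissible f u B)
    (hu : 0 ≤ u) (hu' : u ≤ 1 - f) {a : ℝ} (ha : a ≤ 1) (hAB : EqOn A B (Icc a 1)) :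
    EqOn (step f u A) (step f u B) (Icc (a - f) 1) := by
  intro z hz
  have hm : max 0 (min z u) ∈ Icc 0 u := by simp [hu]
  have hw : a ≤ inv A (max 0 (min z u)) := by
    rcases le_or_gt u z with h | h
    · rw [min_eq_right h, max_eq_right hu, hA.inv_u hu]; exact ha
    · have := hA.add_le_inv hu' hm
      have h2 : z ≤ max 0 (min z u) := by rw [min_eq_left h.le]; exact le_max_right _ _
      linarith [hz.1]
  have hs := hA.inv_spec hm
  have hinv : inv B (max 0 (min z u)) = inv A (max 0 (min z u)) := by
    refine hB.mono.injOn (hB.inv_spec hm).1 hs.1 ?_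
    rw [(hB.inv_spec hm).2, ← hAB ⟨hw, hs.1.2⟩, hs.2]
  have hdef : deficit f u B (inv A (max 0 (min z u))) =
      deficit f u A (inv A (max 0 (min z u))) := by
    simp only [deficit]
    congr 1
    refine intervalIntegral.integral_congr fun σ hσ => ?_
    rw [uIcc_of_le hs.1.2] at hσ
    simp only [hAB ⟨hw.trans hσ.1, hσ.2⟩]
  simp only [step, hinv, hdef]

end
-- Fixed points by iteration, and the choice of `u`.
section
variable {f u : ℝ} {Z : ℝ → ℝ}

theorem admissible_quadratic (hf : 0 < f) (hu : u ≤ 1 - f) :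
    Admissible f u fun s => max s 0 ^ 2 - 1 + u where
  cont := by fun_prop
  mono := by
    intro a ha b hb hab
    simp only [max_eq_left ha.1, max_eq_left hb.1]
    nlinarith [ha.1]
  ratio := by
    intro a ha b hb hab
    simp only [max_eq_left ha.1.le, max_eq_left hb.1.le]
    rw [div_lt_div_iff₀ ha.1 hb.1]
    nlinarith [mul_pos (mul_pos ha.1 hb.1) (sub_pos.2 hab)]
  map_zero := by simp; linarith
  map_one := by simp

/-- The iterates of the truncated integral operator. -/
noncomputable def approx (f u : ℝ) (k : ℕ) : ℝ → ℝ :=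
  (step f u)^[k] fun s => max s 0 ^ 2 - 1 + u

theorem approx_succ (k : ℕ) : approx f u (k + 1) = step f u (approx f u k) := by
  simp only [approx, Function.iterate_succ_apply']

theorem admissible_approx (hf : 0 < f) (hu : 0 ≤ u) (hu' : u ≤ 1 - f) (k : ℕ) :
    Admissible f u (approx f u k) := by
  induction k with
  | zero => exact admissible_quadratic hf hu'
  | succ k ih => rw [approx_succ]; exact admissible_step ih hf hu hu'

theorem continuous_approx {X : Type*} [TopologicalSpace X] (hf : 0 < f) {u : X → ℝ}
    (hc : Continuous u) (hu : ∀ x, 0 ≤ u x) (hu' : ∀ x, u x ≤ 1 - f) (k : ℕ) :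
    Continuous (Function.uncurry fun x => approx f (u x) k) := by
  induction k with
  | zero =>
    have : Continuous fun p : X × ℝ => max p.2 0 ^ 2 - 1 + u p.1 := by fun_prop
    exact this
  | succ k ih =>
    simp only [approx_succ]
    exact continuous_step hf ih hc (fun x => admissible_approx hf (hu x) (hu' x) k) hu

theorem approx_stable (hf : 0 < f) (hu : 0 ≤ u) (hu' : u ≤ 1 - f) (k : ℕ) :
    EqOn (approx f u (k + 1)) (approx f u k) (Icc (1 - k * f) 1) := by
  induction k with
  | zero =>
    intro s hs
    have : s = 1 := le_antisymm hs.2 (by simpa using hs.1)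
    rw [this, (admissible_approx hf hu hu' _).map_one, (admissible_approx hf hu hu' _).map_one]
  | succ k ih =>
    have := step_congr (admissible_approx hf hu hu' (k + 1)) (admissible_approx hf hu hu' k)
      hu hu' (by nlinarith [(Nat.cast_nonneg k : (0 : ℝ) ≤ k)]) ih
    rw [← approx_succ, ← approx_succ] at this
    refine this.mono (Icc_subset_Icc_left ?_)
    push_cast
    linarith

/-- A solution, in rescaled coordinates and in integrated form. -/
structure IntegralSolution (f u : ℝ) (Z : ℝ → ℝ) : Prop extends Admissible f u Z where
  pos : 0 < u
  le : u ≤ 1 - f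
  map_zero_eq : Z 0 = -f
  eq_integral : ∀ z ∈ Icc 0 u, Z z = z ^ 2 / inv Z z - f - deficit f u Z (inv Z z)
  eq_quadratic : ∀ s ∈ Icc u 1, Z s = s ^ 2 - 1 + u

theorem exists_integralSolution (hf : 0 < f) (hf1 : f < 1) : ∃ u Z, IntegralSolution f u Z := by
  -- Since `N f ≥ 1`, the interval `[1 - N f, 1]` of stability contains `[0, 1]`.
  obtain ⟨N, hN⟩ := exists_nat_ge (1 / f)
  rw [div_le_iff₀ hf] at hN
  let X := Icc (0 : ℝ) (1 - f)
  let G : X → ℝ → ℝ := fun x => approx f x N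
  have hA (x : X) : Admissible f x (G x) := admissible_approx hf x.2.1 x.2.2 N
  have hG : Continuous (Function.uncurry G) :=
    continuous_approx hf continuous_subtype_val (fun x => x.2.1) (fun x => x.2.2) N
  have hfix (x : X) : ∀ s ∈ Icc (0 : ℝ) 1, G x s = step f x (G x) s := fun s hs => by
    rw [← approx_succ]
    exact (approx_stable hf x.2.1 x.2.2 N ⟨by linarith [hs.1], hs.2⟩).symm
  let E : X → ℝ := fun x => deficit f x (G x) (inv (G x) 0)
  have hE : Continuous E := by
    refine continuous_deficit hf hG continuous_subtype_val ?_
    exact continuous_inv hG hA continuous_const fun x => ⟨le_rfl, x.2.1⟩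
  have hnonneg (x : X) {a b : ℝ} (ha : inv (G x) 0 ≤ a) (hab : a ≤ b) (hb : b ≤ 1) :
      deficit f x (G x) a ≤ deficit f x (G x) b := by
    have hs := (hA x).inv_spec (z := 0) ⟨le_rfl, x.2.1⟩
    rw [← sub_nonneg, deficit_sub hf (hA x).cont]
    refine intervalIntegral.integral_nonneg hab fun σ hσ => ?_
    have : 0 ≤ G x σ := by
      have := (hA x).mono.monotoneOn hs.1 ⟨hs.1.1.trans (ha.trans hσ.1), hσ.2.trans hb⟩
        (ha.trans hσ.1)
      rwa [hs.2] at this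
    positivity
  have hone (x : X) : deficit f x (G x) 1 = 1 - x - f := by simp [deficit]
  have hX : PreconnectedSpace X := Subtype.preconnectedSpace isPreconnected_Icc
  let x0 : X := ⟨0, le_rfl, by linarith⟩
  let x1 : X := ⟨1 - f, by linarith, le_rfl⟩
  -- For `u = 0` the zero of `Z` is `1` itself; for `u = 1 - f` the deficit is `0` at `1` and no
  -- larger at the zero of `Z`.
  have hx0 : E x0 = 1 - f := by
    have := (hA x0).inv_u le_rfl
    simp only [E]
    rw [this, hone]
    simp [x0]
  have hx1 : E x1 ≤ 0 := by
    have := hnonneg x1 le_rfl ((hA x1).inv_spec ⟨le_rfl, x1.2.1⟩).1.2 le_rfl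
    rw [hone] at this
    simpa [x1] using this
  obtain ⟨x, hx⟩ := mem_range_of_exists_le_of_exists_ge hE ⟨x1, hx1⟩ ⟨x0, by linarith⟩
  have hE0 : deficit f x (G x) (inv (G x) 0) = 0 := hx
  have hpos : 0 < (x : ℝ) := by
    rcases x.2.1.eq_or_lt with h | h
    · have : x = x0 := Subtype.ext h.symm
      rw [this, hx0] at hx
      linarith
    · exact h
  have heq : ∀ z ∈ Icc 0 (x : ℝ), G x z = z ^ 2 / inv (G x) z - f
      - deficit f x (G x) (inv (G x) z) := fun z hz => by
    have hz1 : z ≤ 1 := by linarith [hz.2, x.2.2]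
    -- The deficit increases from `0` at the zero of `Z`, so the cutoff is inactive.
    rw [hfix x z ⟨hz.1, hz1⟩, step_of_mem hz, max_eq_right]
    have := hnonneg x le_rfl ((hA x).inv_strictMono.monotoneOn ⟨le_rfl, x.2.1⟩ hz hz.1)
      ((hA x).inv_spec hz).1.2
    rwa [hE0] at this
  refine ⟨x, G x, { hA x with
    pos := hpos
    le := x.2.2
    map_zero_eq := ?_
    eq_integral := heq
    eq_quadratic := fun s hs => ?_ }⟩
  · rw [heq 0 ⟨le_rfl, hpos.le⟩, hE0]
    simp
  · rw [hfix x s ⟨hpos.le.trans hs.1, hs.2⟩]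
    exact step_of_ge (hA x) hpos.le x.2.2 hs.1

end
-- Differentiability of the integral solution.
section
variable {f u : ℝ} {Z : ℝ → ℝ}

theorem hasDerivAt_deficit (hf : 0 < f) (hZ : Continuous Z) {s : ℝ} (hs : f ≤ s) :
    HasDerivAt (deficit f u Z) (f * Z s / s ^ 2) s := by
  have h := ((continuous_integrand' hf hZ).integral_hasStrictDerivAt s s).hasDerivAt
  have h2 := h.const_add (deficit f u Z s)
  rw [max_eq_left hs] at h2
  refine h2.congr_of_eventuallyEq (Filter.Eventually.of_forall fun x => ?_)
  show deficit f u Z x = deficit f u Z s + _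
  linarith [deficit_sub (u := u) hf hZ s x]

theorem Admissible.continuousOn_inv (h : Admissible f u Z) : ContinuousOn (inv Z) (Icc 0 u) := by
  rw [continuousOn_iff_continuous_domRestrict]
  exact continuous_inv (P := Icc 0 u) (u := fun _ => u) (m := Subtype.val) (G := fun _ => Z)
    (h.cont.comp continuous_snd) (fun _ => h) continuous_subtype_val fun p => p.2

theorem Admissible.hasDerivWithinAt_inv (h : Admissible f u Z) {S T : Set ℝ} {d z : ℝ}
    (hT : T ⊆ Icc 0 u) (hz : z ∈ T) (hST : MapsTo (inv Z) T S)
    (hd : HasDerivWithinAt Z d S (inv Z z)) (hd0 : d ≠ 0) :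
    HasDerivWithinAt (inv Z) d⁻¹ T z := by
  have he : HasFDerivWithinAt Z
      (ContinuousLinearEquiv.unitsEquivAut ℝ (Units.mk0 d hd0) : ℝ →L[ℝ] ℝ) S (inv Z z) := by
    refine hd.hasFDerivWithinAt.congr_fderiv ?_
    ext
    simp
  have ht : Filter.Tendsto (inv Z) (nhdsWithin z T) (nhdsWithin (inv Z z) S) :=
    tendsto_nhdsWithin_of_tendsto_nhds_of_eventually_within _
      ((h.continuousOn_inv.mono hT) z hz)
      (Filter.eventually_of_mem self_mem_nhdsWithin hST)
  have := he.of_local_left_inverse ht hz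
    (Filter.eventually_of_mem self_mem_nhdsWithin fun x hx => (h.inv_spec (hT hx)).2)
  refine (this.hasDerivWithinAt).congr_deriv ?_
  simp

namespace IntegralSolution

theorem lt_one (h : IntegralSolution f u Z) (hf : 0 < f) : u < 1 := by linarith [h.le]

theorem neg_lt (h : IntegralSolution f u Z) {s : ℝ} (hs : s ∈ Ioc (0 : ℝ) 1) : 0 < Z s + f := by
  have := h.mono (by simp) (Ioc_subset_Icc_self hs) hs.1
  rw [h.map_zero_eq] at this
  linarith

/-- At `s = 0` the quotient is `0` by convention, below the positive values elsewhere. Including `0`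
lets the domain be a full interval `[0, s]`. -/
theorem ratio_monotone (h : IntegralSolution f u Z) :
    MonotoneOn (fun s => (Z s + f) / s) (Icc 0 1) := by
  intro a ha b hb hab
  rcases ha.1.eq_or_lt with h0 | h0
  · subst h0
    rcases hab.eq_or_lt with h1 | h1
    · rw [← h1]
    · have := div_pos (h.neg_lt ⟨h1, hb.2⟩) h1
      simpa using this.le
  · exact h.ratio.monotoneOn ⟨h0, ha.2⟩ ⟨h0.trans_le hab, hb.2⟩ hab

/-- The derivative of the monotone ratio is nonnegative. This keeps `Z'` away from `0`, so `inv Z`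
is differentiable. -/
theorem le_mul_deriv (h : IntegralSolution f u Z) {S : Set ℝ} {s d : ℝ} (hs : s ∈ Ioc (0 : ℝ) 1)
    (hS : S ⊆ Icc 0 1) (hu : UniqueDiffWithinAt ℝ S s) (hd : HasDerivWithinAt Z d S s) :
    Z s + f ≤ s * d := by
  have h1 := (hd.add_const f).div (hasDerivWithinAt_id s S) hs.1.ne'
  have h2 : 0 ≤ derivWithin (fun s => (Z s + f) / s) S s :=
    (h.ratio_monotone.mono hS).derivWithin_nonneg
  have h3 : derivWithin (fun s => (Z s + f) / s) S s = _ := h1.derivWithin hu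
  rw [h3] at h2
  have h4 : 0 < s ^ 2 := by have := hs.1; positivity
  simp only [id] at h2
  by_contra! hc
  exact absurd h2 (not_le.2 (div_neg_of_neg_of_pos (by linarith) h4))

theorem deriv_pos (h : IntegralSolution f u Z) {S : Set ℝ} {s d : ℝ} (hs : s ∈ Ioc (0 : ℝ) 1)
    (hS : S ⊆ Icc 0 1) (hu : UniqueDiffWithinAt ℝ S s) (hd : HasDerivWithinAt Z d S s) :
    0 < d :=
  pos_of_mul_pos_right ((h.neg_lt hs).trans_le (h.le_mul_deriv hs hS hu hd)) hs.1.le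

/-- Differentiating the integral equation recovers the differential equation; general `S` and `T`
cover one-sided and ordinary derivatives at once. -/
theorem hasDerivWithinAt_map (h : IntegralSolution f u Z) (hf : 0 < f) {S T : Set ℝ} {d z : ℝ}
    (hT : T ⊆ Icc 0 u) (hz : z ∈ T) (hST : MapsTo (inv Z) T S)
    (hd : HasDerivWithinAt Z d S (inv Z z)) (hd0 : d ≠ 0) :
    HasDerivWithinAt Z (z / inv Z z * (2 - (z + f) / (d * inv Z z))) T z := by
  have hs := h.inv_pos (hT hz)
  have hi := h.hasDerivWithinAt_inv hT hz hST hd hd0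
  have hfw : f ≤ inv Z z := by linarith [h.add_le_inv h.le (hT hz), (hT hz).1]
  have h1 := ((((hasDerivWithinAt_id z T).pow 2).div hi hs.ne').sub_const f).sub
    ((hasDerivAt_deficit (u := u) hf h.cont hfw).comp_hasDerivWithinAt z hi)
  refine (h1.congr (fun x hx => h.eq_integral x (hT hx)) (h.eq_integral z (hT hz))).congr_deriv ?_
  rw [(h.inv_spec (hT hz)).2]
  simp only [id, Nat.cast_ofNat, Nat.add_one_sub_one, pow_one, mul_one, Pi.pow_apply]
  field_simp
  ring

theorem hasDerivWithinAt_left (h : IntegralSolution f u Z) (hf : 0 < f) {s d : ℝ}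
    (hs : s ∈ Icc (0 : ℝ) 1) (hz : 0 < Z s) (hd : HasDerivWithinAt Z d (Icc 0 s) s) :
    0 < d ∧ HasDerivWithinAt Z (Z s / s * (2 - (Z s + f) / (d * s))) (Icc 0 (Z s)) (Z s) := by
  have hi := h.inv_eq hs hz.le
  have hu : Z s ≤ u := h.map_one ▸ h.mono.monotoneOn hs (by simp) hs.2
  have hs0 : 0 < s := hi ▸ h.inv_pos ⟨hz.le, hu⟩
  have hd0 := h.deriv_pos ⟨hs0, hs.2⟩ (Icc_subset_Icc_right hs.2)
    (uniqueDiffOn_Icc hs0 s (by simp [hs0.le])) hd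
  refine ⟨hd0, ?_⟩
  have := h.hasDerivWithinAt_map hf (S := Icc 0 s) (T := Icc 0 (Z s)) (z := Z s) (d := d)
    (Icc_subset_Icc_right hu) (by simp [hz.le]) (fun x hx => ?_) (by rwa [hi]) hd0.ne'
  · rwa [hi] at this
  · have hx' : x ∈ Icc 0 u := ⟨hx.1, hx.2.trans hu⟩
    refine ⟨(h.inv_spec hx').1.1, ?_⟩
    rw [← hi]
    exact h.inv_strictMono.monotoneOn hx' ⟨hz.le, hu⟩ hx.2

theorem hasDerivWithinAt_right (h : IntegralSolution f u Z) (hf : 0 < f) {s d : ℝ}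
    (hs : s ∈ Ico (0 : ℝ) 1) (hz : 0 ≤ Z s) (hd : HasDerivWithinAt Z d (Icc s 1) s) :
    0 < d ∧ HasDerivWithinAt Z (Z s / s * (2 - (Z s + f) / (d * s))) (Icc (Z s) 1) (Z s) := by
  have hs' := Ico_subset_Icc_self hs
  have hi := h.inv_eq hs' hz
  have hu : Z s < u := h.map_one ▸ h.mono hs' (by simp) hs.2
  have hs0 : 0 < s := hi ▸ h.inv_pos ⟨hz, hu.le⟩
  have hd0 := h.deriv_pos ⟨hs0, hs.2.le⟩ (Icc_subset_Icc_left hs.1)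
    (uniqueDiffOn_Icc hs.2 s (by simp [hs.2.le])) hd
  refine ⟨hd0, ?_⟩
  have := h.hasDerivWithinAt_map hf (S := Icc s 1) (T := Icc (Z s) u) (z := Z s) (d := d)
    (Icc_subset_Icc_left hz) (by simp [hu.le]) (fun x hx => ?_) (by rwa [hi]) hd0.ne'
  · rw [hi] at this
    exact this.mono_of_mem_nhdsWithin (Icc_mem_nhdsGE_of_mem ⟨le_rfl, hu⟩ |>
      nhdsWithin_mono _ Icc_subset_Ici_self)
  · have hx' : x ∈ Icc 0 u := ⟨hz.trans hx.1, hx.2⟩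
    refine ⟨?_, (h.inv_spec hx').1.2⟩
    rw [← hi]
    exact h.inv_strictMono.monotoneOn ⟨hz, hu.le⟩ hx' hx.1

theorem hasDerivWithinAt_ordinary (h : IntegralSolution f u Z) (hf : 0 < f) {s d : ℝ}
    (hs : s ∈ Ico (0 : ℝ) 1) (hz : 0 ≤ Z s) (hd : HasDerivWithinAt Z d (Icc 0 1) s) :
    0 < d ∧ HasDerivWithinAt Z (Z s / s * (2 - (Z s + f) / (d * s))) (Icc 0 1) (Z s) := by
  have hs' := Ico_subset_Icc_self hs
  have hi := h.inv_eq hs' hz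
  have hu : Z s < u := h.map_one ▸ h.mono hs' (by simp) hs.2
  have hs0 : 0 < s := hi ▸ h.inv_pos ⟨hz, hu.le⟩
  have hd0 := h.deriv_pos ⟨hs0, hs.2.le⟩ subset_rfl (uniqueDiffOn_Icc one_pos s hs') hd
  refine ⟨hd0, ?_⟩
  have := h.hasDerivWithinAt_map hf (S := Icc 0 1) (T := Icc 0 u) (z := Z s) (d := d)
    subset_rfl ⟨hz, hu.le⟩ (fun x hx => (h.inv_spec hx).1) (by rwa [hi]) hd0.ne'
  rw [hi] at this
  refine this.mono_of_mem_nhdsWithin ?_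
  filter_upwards [self_mem_nhdsWithin, mem_nhdsWithin_of_mem_nhds (Iio_mem_nhds hu)] with x hx hx'
  exact ⟨hx.1, le_of_lt hx'⟩

theorem hasDerivWithinAt_quadratic (h : IntegralSolution f u Z) (S : Set ℝ) (hS : S ⊆ Icc u 1)
    {s : ℝ} (hs : s ∈ S) : HasDerivWithinAt Z (2 * s) S s := by
  have : HasDerivWithinAt (fun x : ℝ => x ^ 2 - 1 + u) (2 * s) S s := by
    simpa using ((((hasDerivAt_id s).pow 2).sub_const 1).add_const u).hasDerivWithinAt (s := S)
  exact this.congr (fun x hx => h.eq_quadratic x (hS hx)) (h.eq_quadratic s (hS hs))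

/-- Above `u` the quadratic is differentiable; below, a derivative at `inv Z s ≥ s + f` yields one
at `s`. -/
theorem exists_deriv_of_le (h : IntegralSolution f u Z) (hf : 0 < f) (k : ℕ) :
    ∀ s ∈ Ioc (0 : ℝ) 1, 1 - k * f ≤ s →
      (∃ d, HasDerivWithinAt Z d (Icc 0 s) s) ∧ (s < 1 → ∃ d, HasDerivWithinAt Z d (Icc s 1) s) ∧
        (s ∉ breakpoints 0 Z → ∃ d, HasDerivWithinAt Z d (Icc 0 1) s) := by
  have hgt : ∀ s ∈ Ioc (0 : ℝ) 1, u < s → HasDerivWithinAt Z (2 * s) (Icc 0 1) s := by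
    intro s hs hus
    refine (h.hasDerivWithinAt_quadratic (Icc u 1) subset_rfl ⟨hus.le, hs.2⟩).mono_of_mem_nhdsWithin
      ?_
    filter_upwards [self_mem_nhdsWithin, mem_nhdsWithin_of_mem_nhds (Ioi_mem_nhds hus)] with x hx hx'
    exact ⟨le_of_lt hx', hx.2⟩
  have hu1 := h.lt_one hf
  induction k with
  | zero =>
    intro s hs hks
    have hs1 : s = 1 := le_antisymm hs.2 (by simpa using hks)
    have := hgt s hs (by rw [hs1]; exact hu1)
    exact ⟨⟨_, this.mono (Icc_subset_Icc_right hs.2)⟩, fun h' => absurd hs1 h'.ne,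
      fun _ => ⟨_, this⟩⟩
  | succ k ih =>
    intro s hs hks
    rcases lt_or_ge u s with hus | hus
    · have := hgt s hs hus
      exact ⟨⟨_, this.mono (Icc_subset_Icc_right hs.2)⟩,
        fun _ => ⟨_, this.mono (Icc_subset_Icc_left hs.1.le)⟩, fun _ => ⟨_, this⟩⟩
    · have hsu : s ∈ Icc 0 u := ⟨hs.1.le, hus⟩
      obtain ⟨hw, hZw⟩ := h.inv_spec hsu
      have hwk : 1 - k * f ≤ inv Z s := by
        have := h.add_le_inv h.le hsu
        push_cast at hks
        linarith
      obtain ⟨⟨dL, hL⟩, hR, hO⟩ := ih _ ⟨h.inv_pos hsu, hw.2⟩ hwk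
      have hs0 : 0 < Z (inv Z s) := by rw [hZw]; exact hs.1
      have hL' := (h.hasDerivWithinAt_left hf hw hs0 hL).2
      rw [hZw] at hL'
      refine ⟨⟨_, hL'⟩, fun _ => ?_, fun hb => ?_⟩
      -- At `s = u` the preimage is `1`, which has no right neighbourhood; the quadratic supplies
      -- the right derivative.
      · rcases hus.eq_or_lt with h1 | h1
        · exact ⟨_, h.hasDerivWithinAt_quadratic _ (Icc_subset_Icc_left h1.ge)
            (left_mem_Icc.2 hs.2)⟩
        · have hw1 : inv Z s < 1 := by
            have := h.inv_strictMono hsu ⟨h.pos.le, le_rfl⟩ h1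
            rwa [h.inv_u h.pos.le] at this
          obtain ⟨d, hd⟩ := hR hw1
          have := (h.hasDerivWithinAt_right hf ⟨hw.1, hw1⟩ hs0.le hd).2
          rw [hZw] at this
          exact ⟨_, this⟩
      · have hw1 : inv Z s < 1 := by
          refine lt_of_le_of_ne hw.2 fun h1 => hb ⟨1, fun i hi => ?_, ?_⟩
          · simp [Nat.lt_one_iff.1 hi]
          · rw [Function.iterate_one, ← h1, hZw]
        have hwb : inv Z s ∉ breakpoints 0 Z := by
          rintro ⟨n, hn, hn'⟩
          refine hb ⟨n + 1, fun i hi => ?_, ?_⟩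
          · rcases (Nat.lt_succ_iff.1 hi).eq_or_lt with rfl | h1
            · rw [hn']; exact hw
            · exact hn i h1
          · rw [Function.iterate_succ_apply', hn', hZw]
        obtain ⟨d, hd⟩ := hO hwb
        have := (h.hasDerivWithinAt_ordinary hf ⟨hw.1, hw1⟩ hs0.le hd).2
        rw [hZw] at this
        exact ⟨_, this⟩

theorem exists_deriv (h : IntegralSolution f u Z) (hf : 0 < f) {s : ℝ} (hs : s ∈ Ioc (0 : ℝ) 1) :
    (∃ d, HasDerivWithinAt Z d (Icc 0 s) s) ∧ (s < 1 → ∃ d, HasDerivWithinAt Z d (Icc s 1) s) ∧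
      (s ∉ breakpoints 0 Z → ∃ d, HasDerivWithinAt Z d (Icc 0 1) s) := by
  obtain ⟨k, hk⟩ := exists_nat_ge (1 / f)
  rw [div_le_iff₀ hf] at hk
  exact h.exists_deriv_of_le hf k s hs (by linarith [hs.1])

end IntegralSolution

/-! ### The differential equation in rescaled coordinates. -/

/-- The equation in rescaled coordinates, where the constant `c f` is moved to `0`. -/
def ScaledEqAt (f : ℝ) (Z : ℝ → ℝ) (S T : Set ℝ) (s : ℝ) : Prop :=
  ∃ d, HasDerivWithinAt Z d S s ∧ d ≠ 0 ∧
    HasDerivWithinAt Z (Z s / s * (2 - (Z s + f) / (d * s))) T (Z s)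

/-- A solution in rescaled coordinates, where the interval `[c f, 1]` becomes `[0, 1]`. -/
structure ScaledSolution (f : ℝ) (Z : ℝ → ℝ) : Prop where
  cont : Continuous Z
  mono : StrictMonoOn Z (Icc 0 1)
  ratio : StrictMonoOn (fun s => (Z s + f) / s) (Ioc 0 1)
  map_zero : Z 0 = -f
  map_one_le : Z 1 ≤ 1 - f
  eq_ordinary : ∀ s ∈ Icc (0 : ℝ) 1, 0 ≤ Z s → s ∉ breakpoints 0 Z →
    ScaledEqAt f Z (Icc 0 1) (Icc 0 1) s
  eq_left : ∀ s ∈ Icc (0 : ℝ) 1, 0 < Z s → ScaledEqAt f Z (Icc 0 s) (Icc 0 (Z s)) s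
  eq_right : ∀ s ∈ Ico (0 : ℝ) 1, 0 ≤ Z s → ScaledEqAt f Z (Icc s 1) (Icc (Z s) 1) s
  initial : ∀ s ∈ Icc (0 : ℝ) 1, Z 1 ≤ s → Z s = s ^ 2 - 1 + Z 1

theorem one_mem_breakpoints (k : ℝ) (y : ℝ → ℝ) : 1 ∈ breakpoints k y := ⟨0, by simp, rfl⟩

theorem IntegralSolution.scaledSolution (h : IntegralSolution f u Z) (hf : 0 < f) :
    ScaledSolution f Z := by
  have hpos : ∀ s ∈ Icc (0 : ℝ) 1, 0 ≤ Z s → 0 < s := fun s hs hz => by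
    rcases hs.1.eq_or_lt with h0 | h0
    · rw [← h0, h.map_zero_eq] at hz
      linarith
    · exact h0
  refine ⟨h.cont, h.mono, h.ratio, h.map_zero_eq, h.map_one.trans_le h.le, fun s hs hz hb => ?_,
    fun s hs hz => ?_, fun s hs hz => ?_, fun s hs hs' => ?_⟩
  · have hs1 : s ≠ 1 := fun h1 => hb (h1 ▸ one_mem_breakpoints 0 Z)
    obtain ⟨d, hd⟩ := (h.exists_deriv hf ⟨hpos s hs hz, hs.2⟩).2.2 hb
    obtain ⟨h1, h2⟩ := h.hasDerivWithinAt_ordinary hf ⟨hs.1, lt_of_le_of_ne hs.2 hs1⟩ hz hd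
    exact ⟨d, hd, h1.ne', h2⟩
  · obtain ⟨d, hd⟩ := (h.exists_deriv hf ⟨hpos s hs hz.le, hs.2⟩).1
    obtain ⟨h1, h2⟩ := h.hasDerivWithinAt_left hf hs hz hd
    exact ⟨d, hd, h1.ne', h2⟩
  · obtain ⟨d, hd⟩ := (h.exists_deriv hf ⟨hpos s ⟨hs.1, hs.2.le⟩ hz, hs.2.le⟩).2.1 hs.2
    obtain ⟨h1, h2⟩ := h.hasDerivWithinAt_right hf hs hz hd
    exact ⟨d, hd, h1.ne', h2⟩
  · rw [h.map_one] at hs' ⊢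
    exact h.eq_quadratic s ⟨hs', hs.2⟩

/-- The equation is almost vacuous: `s ^ 2 ≥ f ≥ 1` leaves only `s = 1`, a breakpoint with value at
most `0`. -/
theorem scaledSolution_quadratic (hf : 1 ≤ f) : ScaledSolution f fun s => s ^ 2 - f where
  cont := by fun_prop
  mono := fun a ha b hb hab => by dsimp only; nlinarith [ha.1]
  ratio := fun a ha b hb hab => by
    have e (x : ℝ) : (x ^ 2 - f + f) / x = x := by
      rw [sub_add_cancel, sq, mul_self_div_self]
    simpa only [e] using hab
  map_zero := by simp
  map_one_le := by simp
  eq_ordinary := fun s hs hz hb => by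
    have : s = 1 := by nlinarith [hs.1, hs.2]
    exact absurd (this ▸ one_mem_breakpoints _ _) hb
  eq_left := fun s hs hz => by nlinarith [hs.1, hs.2]
  eq_right := fun s hs hz => by nlinarith [hs.1, hs.2]
  initial := fun s _ _ => by ring

theorem exists_scaledSolution (hf : 0 < f) : ∃ Z, ScaledSolution f Z := by
  rcases lt_or_ge f 1 with h1 | h1
  · obtain ⟨u, Z, h⟩ := exists_integralSolution hf h1
    exact ⟨Z, h.scaledSolution hf⟩
  · exact ⟨_, scaledSolution_quadratic h1⟩

end
-- Return to the original coordinates, and the bound on iterates.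
section
variable {f : ℝ} {Z : ℝ → ℝ}

/-- The affine map of `[c f, 1]` onto `[0, 1]`. -/
def rescale (f t : ℝ) : ℝ := (1 + f) * t - f

/-- The function `Z` in the original coordinates. -/
noncomputable def unscale (f : ℝ) (Z : ℝ → ℝ) (t : ℝ) : ℝ := (Z (rescale f t) + f) / (1 + f)

theorem rescale_strictMono (hf : 0 < f) : StrictMono (rescale f) := fun a b hab => by
  simp only [rescale]
  nlinarith

theorem rescale_one : rescale f 1 = 1 := by simp [rescale]

theorem rescale_c (hf : 0 < f) : rescale f (c f) = 0 := by
  simp only [rescale, c]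
  field_simp
  ring

theorem rescale_unscale (hf : 0 < f) (t : ℝ) : rescale f (unscale f Z t) = Z (rescale f t) := by
  simp only [rescale, unscale]
  field_simp
  ring

theorem sub_c (hf : 0 < f) (t : ℝ) : t - c f = rescale f t / (1 + f) := by
  simp only [rescale, c]
  field_simp

theorem mapsTo_rescale (hf : 0 < f) (a b : ℝ) :
    MapsTo (rescale f) (Icc a b) (Icc (rescale f a) (rescale f b)) :=
  fun _ ht => ⟨(rescale_strictMono hf).monotone ht.1, (rescale_strictMono hf).monotone ht.2⟩

theorem rescale_mem_Icc (hf : 0 < f) {t : ℝ} : rescale f t ∈ Icc 0 1 ↔ t ∈ Icc (c f) 1 := by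
  rw [← rescale_c hf]
  conv_lhs => rw [← rescale_one (f := f)]
  simp only [mem_Icc, (rescale_strictMono hf).le_iff_le]

theorem rescale_iterate (hf : 0 < f) (n : ℕ) :
    rescale f ((unscale f Z)^[n] 1) = Z^[n] 1 := by
  have h : Function.Semiconj (rescale f) (unscale f Z) Z := rescale_unscale hf
  rw [(h.iterate_right n).eq, rescale_one]

theorem mem_breakpoints_unscale (hf : 0 < f) {t : ℝ} (ht : rescale f t ∈ breakpoints 0 Z) :
    t ∈ breakpoints (c f) (unscale f Z) := by
  obtain ⟨n, hn, hn'⟩ := ht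
  refine ⟨n, fun i hi => ?_, (rescale_strictMono hf).injective ?_⟩
  · rw [← rescale_mem_Icc hf, rescale_iterate hf]
    exact hn i hi
  · rw [rescale_iterate hf, hn']

theorem hasDerivWithinAt_unscale (hf : 0 < f) {S S' : Set ℝ} {d t : ℝ}
    (hS : MapsTo (rescale f) S S') (hd : HasDerivWithinAt Z d S' (rescale f t)) :
    HasDerivWithinAt (unscale f Z) d S t := by
  have h1 : HasDerivWithinAt (rescale f) (1 + f) S t := by
    exact ((((hasDerivAt_id t).const_mul (1 + f)).sub_const f).hasDerivWithinAt
      (s := S)).congr_deriv (mul_one _)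
  refine (((hd.comp t h1 hS).add_const f).div_const (1 + f)).congr_deriv ?_
  field_simp

theorem ScaledEqAt.eqAt (hf : 0 < f) {S S' T T' : Set ℝ} {t : ℝ}
    (h : ScaledEqAt f Z S' T' (rescale f t)) (hS : MapsTo (rescale f) S S')
    (hT : MapsTo (rescale f) T T') : EqAt f (unscale f Z) S T t := by
  obtain ⟨d, hd, hd0, he⟩ := h
  rw [← rescale_unscale (Z := Z) hf t] at he
  refine ⟨d, _, hasDerivWithinAt_unscale hf hS hd, hasDerivWithinAt_unscale hf hT he, hd0, ?_⟩
  have hf' : 1 + f ≠ 0 := by positivity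
  have e1 : rescale f (unscale f Z t) + f = unscale f Z t * (1 + f) := by
    simp only [rescale]
    ring
  have e2 : unscale f Z t / (d * (rescale f t / (1 + f))) =
      (rescale f (unscale f Z t) + f) / (d * rescale f t) := by
    rw [e1, ← mul_div_assoc, div_div_eq_mul_div]
  rw [sub_c hf t, sub_c hf (unscale f Z t), div_div_div_cancel_right₀ hf', e2]

namespace ScaledSolution

theorem le_sub (h : ScaledSolution f Z) {s : ℝ} (hs : s ∈ Icc (0 : ℝ) 1) : Z s ≤ s - f := by
  rcases hs.1.eq_or_lt with h0 | h0
  · rw [← h0, h.map_zero, zero_sub]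
  · have := h.ratio.monotoneOn ⟨h0, hs.2⟩ (by simp : (1 : ℝ) ∈ Ioc (0 : ℝ) 1) hs.2
    simp only [div_one] at this
    rw [div_le_iff₀ h0] at this
    nlinarith [h.map_one_le]

theorem isSolution (h : ScaledSolution f Z) (hf : 0 < f) :
    IsSolution f (c f) (unscale f Z) := by
  have hf1 : 0 < 1 + f := by positivity
  have hr := fun {t} => rescale_mem_Icc hf (t := t)
  have hS : MapsTo (rescale f) (Icc (c f) 1) (Icc 0 1) := fun t ht => hr.2 ht
  have hl (b : ℝ) : MapsTo (rescale f) (Icc (c f) b) (Icc 0 (rescale f b)) := by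
    simpa only [rescale_c hf] using mapsTo_rescale hf (c f) b
  have hrt (a : ℝ) : MapsTo (rescale f) (Icc a 1) (Icc (rescale f a) 1) := by
    simpa only [rescale_one] using mapsTo_rescale hf a 1
  have hle {t : ℝ} (ht : c f ≤ t) : 0 ≤ rescale f t :=
    rescale_c hf ▸ (rescale_strictMono hf).monotone ht
  refine ⟨fun t ht => ?_, ?_, fun t ht hy hb => ?_, fun t ht hy => ?_, fun t ht hy => ?_,
    fun t ht hy => ?_⟩
  · have h1 := h.mono.monotoneOn (by simp) (hr.2 ht) (hr.2 ht).1
    rw [h.map_zero] at h1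
    have h2 := h.le_sub (hr.2 ht)
    refine ⟨div_nonneg (by linarith) hf1.le, (div_le_one hf1).2 ?_⟩
    linarith [(hr.2 ht).2]
  · simp [unscale, rescale_c hf, h.map_zero]
  · have hz := hle hy
    rw [rescale_unscale hf] at hz
    exact (h.eq_ordinary _ (hr.2 ht) hz fun hb' => hb (mem_breakpoints_unscale hf hb')).eqAt hf
      hS hS
  · have hz := rescale_strictMono hf hy
    rw [rescale_unscale hf, rescale_c hf] at hz
    refine (h.eq_left _ (hr.2 ht) hz).eqAt hf (hl t) ?_
    rw [← rescale_unscale (Z := Z) hf]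
    exact hl _
  · have hz := hle hy
    rw [rescale_unscale hf] at hz
    have ht1 := rescale_strictMono hf ht.2
    rw [rescale_one] at ht1
    refine (h.eq_right _ ⟨(hr.2 ⟨ht.1, ht.2.le⟩).1, ht1⟩ hz).eqAt hf (hrt t) ?_
    rw [← rescale_unscale (Z := Z) hf]
    exact hrt _
  · have hz := (rescale_strictMono hf).monotone hy
    rw [rescale_unscale hf, rescale_one] at hz
    have := h.initial _ (hr.2 ht) hz
    rw [sub_c hf]
    simp only [unscale, this, rescale_one, c]
    field_simp
    ring

theorem strictMonoOn_unscale (h : ScaledSolution f Z) (hf : 0 < f) :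
    StrictMonoOn (unscale f Z) (Icc (c f) 1) := fun a ha b hb hab => by
  have := h.mono ((rescale_mem_Icc hf).2 ha) ((rescale_mem_Icc hf).2 hb) (rescale_strictMono hf hab)
  have hf1 : 0 < 1 + f := by positivity
  simp only [unscale]
  gcongr

theorem strictMonoOn_unscale_div (h : ScaledSolution f Z) (hf : 0 < f) :
    StrictMonoOn (fun t => unscale f Z t / (t - c f)) (Ioc (c f) 1) := fun a ha b hb hab => by
  have hm := rescale_strictMono hf
  have hmem : ∀ x ∈ Ioc (c f) 1, rescale f x ∈ Ioc 0 1 := fun x hx =>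
    ⟨by simpa only [rescale_c hf] using hm hx.1, by simpa only [rescale_one] using hm.monotone hx.2⟩
  have hf1 : 1 + f ≠ 0 := by positivity
  simp only [sub_c hf, unscale, div_div_div_cancel_right₀ hf1]
  exact h.ratio (hmem a ha) (hmem b hb) (hm hab)

theorem iterate_le (h : ScaledSolution f Z) (n : ℕ) (hn : ∀ i < n, Z^[i] 1 ∈ Icc (0 : ℝ) 1) :
    Z^[n] 1 ≤ 1 - n * f := by
  induction n with
  | zero => simp
  | succ n ih =>
    have h1 := ih fun i hi => hn i (hi.trans n.lt_succ_self)
    have h2 := h.le_sub (hn n n.lt_succ_self)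
    rw [Function.iterate_succ_apply']
    push_cast
    linarith

theorem exists_iterate_nonpos (h : ScaledSolution f Z) (hf : 0 < f) :
    ∃ n : ℕ, (n : ℝ) ≤ 1 + 1 / f ∧ (∀ i < n, Z^[i] 1 ∈ Icc (0 : ℝ) 1) ∧ Z^[n] 1 ≤ 0 := by
  classical
  have hmem : ∀ n : ℕ, (∀ i < n, 0 < Z^[i] 1) → ∀ i < n, Z^[i] 1 ∈ Icc (0 : ℝ) 1 := by
    intro n
    induction n with
    | zero => simp
    | succ n ih =>
      intro hpos i hi
      have h1 := ih fun j hj => hpos j (hj.trans n.lt_succ_self)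
      rcases (Nat.lt_succ_iff.1 hi).eq_or_lt with rfl | h2
      · have := h.iterate_le i h1
        exact ⟨(hpos i hi).le, by nlinarith [(Nat.cast_nonneg i : (0 : ℝ) ≤ i)]⟩
      · exact h1 i h2
  have hex : ∃ n, Z^[n] 1 ≤ 0 := by
    by_contra! hc
    obtain ⟨N, hN⟩ := exists_nat_ge (1 / f)
    rw [div_le_iff₀ hf] at hN
    have := h.iterate_le N (hmem N fun i _ => hc i)
    linarith [hc N]
  have hpos : ∀ i < Nat.find hex, 0 < Z^[i] 1 := fun i hi => not_le.1 (Nat.find_min hex hi)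
  refine ⟨Nat.find hex, ?_, hmem _ hpos, Nat.find_spec hex⟩
  -- For the least `n = k + 1`, positivity of the iterate `k` gives `0 < 1 - k f`, hence `n ≤ 1 + 1
  -- / f`.
  rcases hk : Nat.find hex with _ | k
  · simp only [Nat.cast_zero]
    positivity
  · rw [hk] at hpos
    have h1 := h.iterate_le k (hmem k fun i hi => hpos i (hi.trans k.lt_succ_self))
    have h2 := hpos k k.lt_succ_self
    have : (k : ℝ) ≤ 1 / f := by
      rw [le_div_iff₀ hf]
      linarith
    push_cast
    linarith

end ScaledSolution
end
end Buyback

/-! ### Assembly of the theorem. -/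

theorem mainTheorem4 (f : ℝ) (hf : 0 < f) :
    ∃ y : ℝ → ℝ,
      Buyback.IsSolution f (Buyback.c f) y ∧
      ContinuousOn y (Set.Icc (Buyback.c f) 1) ∧
      StrictMonoOn y (Set.Icc (Buyback.c f) 1) ∧
      (∀ t ∈ Set.Icc (Buyback.c f) 1, y t < t) ∧
      StrictMonoOn (fun t => y t / (t - Buyback.c f)) (Set.Ioc (Buyback.c f) 1) ∧
      StrictMonoOn
        (fun s => s / (Function.invFunOn y (Set.Icc (Buyback.c f) 1) s - Buyback.c f))
        (Set.Ioc 0 (y 1)) ∧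
      ∃ n : ℕ, (n : ℝ) ≤ 1 + 1 / f ∧
        (∀ i < n, y^[i] 1 ∈ Set.Icc (Buyback.c f) 1) ∧ y^[n] 1 ≤ Buyback.c f := by
  obtain ⟨Z, h⟩ := Buyback.exists_scaledSolution hf
  have hf1 : 0 < 1 + f := by positivity
  have hsol := h.isSolution hf
  have hmono := h.strictMonoOn_unscale hf
  have hcont : Continuous (Buyback.unscale f Z) := by
    have hr : Continuous (Buyback.rescale f) := by
      unfold Buyback.rescale
      fun_prop
    exact ((h.cont.comp hr).add continuous_const).div_const _
  have hc1 : Buyback.c f ≤ 1 := (div_le_one hf1).2 (by linarith)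
  refine ⟨Buyback.unscale f Z, hsol, hcont.continuousOn, hmono, fun t ht => ?_,
    h.strictMonoOn_unscale_div hf, ?_, ?_⟩
  · rw [← (Buyback.rescale_strictMono hf).lt_iff_lt, Buyback.rescale_unscale hf]
    linarith [h.le_sub ((Buyback.rescale_mem_Icc hf).2 ht)]
  · have hinv : ∀ s ∈ Ioc 0 (Buyback.unscale f Z 1),
        Function.invFunOn (Buyback.unscale f Z) (Icc (Buyback.c f) 1) s ∈ Ioc (Buyback.c f) 1 ∧
        Buyback.unscale f Z
          (Function.invFunOn (Buyback.unscale f Z) (Icc (Buyback.c f) 1) s) = s := by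
      intro s hs
      have hex : ∃ a ∈ Icc (Buyback.c f) 1, Buyback.unscale f Z a = s :=
        intermediate_value_Icc hc1 hcont.continuousOn ⟨hsol.map_left ▸ hs.1.le, hs.2⟩
      have h1 := Function.invFunOn_mem hex
      have h2 := Function.invFunOn_eq hex
      refine ⟨⟨lt_of_le_of_ne h1.1 fun h0 => ?_, h1.2⟩, h2⟩
      rw [← h0, hsol.map_left] at h2
      exact hs.1.ne h2
    intro a ha b hb hab
    obtain ⟨ha1, ha2⟩ := hinv a ha
    obtain ⟨hb1, hb2⟩ := hinv b hb
    have hlt := (hmono.lt_iff_lt (Ioc_subset_Icc_self ha1) (Ioc_subset_Icc_self hb1)).1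
      (by rwa [ha2, hb2])
    have := h.strictMonoOn_unscale_div hf ha1 hb1 hlt
    simpa only [ha2, hb2] using this
  · obtain ⟨n, hn, hmem, hle⟩ := h.exists_iterate_nonpos hf
    refine ⟨n, hn, fun i hi => ?_, ?_⟩
    · rw [← Buyback.rescale_mem_Icc hf, Buyback.rescale_iterate hf]
      exact hmem i hi
    · rw [← (Buyback.rescale_strictMono hf).le_iff_le, Buyback.rescale_iterate hf,
        Buyback.rescale_c hf]
      exact hle
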